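/- A $(K,K',N)$ hotplug coded caching system has a server with $N\ge 1$ files of $B$ bits each and $K$ users, each with a cache of $MB$ bits. The caches are filled as functions of the files, before it is known which users will be active. Afterwards a set $I$ of exactly $K'$ users becomes active, each $k\in I$ demands a file $d_k$, and the server broadcasts at most $RB$ bits, depending on the files, on $I$ and on the demands, from which each active user, using its cache, must recover its demanded file without error, for every $I$, all demands and all files. The pair $(M,R)$ is achievable if this is possible for some $B\ge1$. The cut-set bound for $N$ files and $K'$ users is $\max_{1\le s\le\min(N,K')}\bigl(s-\frac{s}{\lfloor N/s\rfloor}M\bigr)$. Let $K\ge 6$ be even, let $N\ge 1$, and let $a,a_1,a_2$ be integers with $0\le a_1\le\binom{K-4}{2}$, $0\le a_2\le\frac32(K-4)$, $0\le a<a_2$ and $\binom{K-1}{2}=a+3a_1+2a_2$. Put $$\frac MN=\frac{\binom{K-1}{2}}{3(a_1+a_2)},\qquad R=\frac{3(a_1+a_2)-\binom{K-1}{2}}{3(a_1+a_2)}=1-\frac MN .$$ Then $(M,R)$ is achievable for the $(K,3,N)$ hotplug coded caching system, $R$ equals the cut-set bound for $N$ files and $3$ users at memory $M$, and the point is optimal: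 every rate achievable with memory $M$ is at least $R$. Moreover the point is attained by the improved $t$-scheme of $3$-$(K,4,3)$ designs, as follows. There exists a $3$-$(K,4,3)$ design on the point set $[K]$ (a family of $b$ blocks of size $4$, repetitions allowed, such that every three points lie in exactly $3$ blocks). For each such design with blocks $A_1,\dots,A_b$, let $P$ be the $b\times K$ array with a star at $(f,k)$ if $k\in A_f$ and a null entry otherwise, and let $B$ be the array with columns $[3]$ and rows $(Y,i)$, where $Y\subset[3]$, $|Y|\in\{1,2\}$, $1\le i\le a_{|Y|}$, whose entry at $((Y,i),j)$ is a star if $j\in Y$ and the symbol $(Y\cup\{j\},i)$ otherwise. Then: 1. $(P,B)$ is a $(K,3,F,F',Z,Z',S)$ hotplug placement delivery array with $F=b$, $F'=3(a_1+a_2)$, $Z=\binom{K-1}{2}$, $Z'=a_1+2a_2$, $S=3a_1+a_2$. That is: $F'\le F$ and $Z<F'$; each column of $P$ has $Z$ stars; $B$ has $F'$ rows, $S$ symbols, each of which occurs, and $Z'$ stars in each column, and two different positions of $B$ with the same symbol lie in different rows and columns, the other two corners of the rectangle they span being stars; and for every $3$-subset $I$ of $[K]$ there are $F'$ rows of $P$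 which, suitably ordered, have in the columns $I$ (in increasing order) exactly the star positions of $B$. 2. There is a set $T$ of symbols of $B$ with at most $Z-Z'$ elements in each column of $B$ and with $R=(S-|T|)/F'$, such that the following scheme is correct for every finite field $\mathbb F$, every $[F,F']$ MDS code over $\mathbb F$, and every choice, for each $I$, of $F'$ ordered rows $\zeta_I$ as in 1. Each file is split into $F'$ subfiles in $\mathbb F$, which are encoded by the MDS code into coded subfiles $C_{n,f}$, $f\in[F]$; user $k$ stores all $C_{n,f}$ with a star at $(f,k)$ in $P$; when the users in $I$ demand the files $d_k$, $k\in I$, the server sends for each symbol $x\notin T$ the sum of the $C_{d_k,f}$ over the positions $(f,k)$ of $x$ in the array obtained by placing $B$ on the rows $\zeta_I$ and the columns $I$. Such MDS codes exist over every finite field with at least $b$ elements. -/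

import Mathlib

/-! ### Hotplug coded caching systems -/

/-- The placement and delivery maps of a `(K, K', N)` hotplug coded caching scheme.
The placement of user `k` depends on the `N` files only; the transmission depends moreover on the
set `I` of the `K'` active users and on their demands `d`. -/
structure HotplugScheme (K K' N : ℕ) (File : Type*) (Cache : Fin K → Type*) (Signal : Type*) where
  place : (k : Fin K) → (Fin N → File) → Cache k
  deliver : (I : Finset (Fin K)) → I.card = K' → (I → Fin N) → (Fin N → File) → Signal

/-- Every active user recovers the file it demands, without error, from its cache and the
transmission, for all active sets of size `K'`, all demands and all file contents. -/
def HotplugScheme.Correct {K K' N : ℕ} {File : Type*} {Cache : Fin K → Type*} {Signal : Type*}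
    (s : HotplugScheme K K' N File Cache Signal) : Prop :=
  ∀ (I : Finset (Fin K)) (hI : I.card = K') (d : I → Fin N) (k : I),
    ∃ dec : Cache k → Signal → File,
      ∀ W : Fin N → File, dec (s.place k W) (s.deliver I hI d W) = W (d k)

/-- The memory-rate pair `(M, R)` is achievable for the `(K, K', N)` hotplug system: for some file
size of `B` bits there is a correct scheme whose caches hold at most `M * B` bits and whose
transmissions have at most `R * B` bits. -/
def HotplugAchievable (K K' N : ℕ) (M R : ℝ) : Prop :=
  ∃ B c l : ℕ, 0 < B ∧ (c : ℝ) ≤ M * B ∧ (l : ℝ) ≤ R * B ∧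
    ∃ s : HotplugScheme K K' N (Fin B → Bool) (fun _ => Fin c → Bool) (Fin l → Bool), s.Correct

/-- The numbers `s - s / ⌊N / s⌋ * M` for `1 ≤ s ≤ min (N, K')`, whose maximum is the
cut-set bound for `N` files, `K'` users and cache size `M` files. -/
def cutSetValues (N K' : ℕ) (M : ℝ) : Set ℝ :=
  (fun s : ℕ => (s : ℝ) - (s : ℝ) / ((N / s : ℕ) : ℝ) * M) '' Set.Icc 1 (min N K')

/-! ### Placement delivery arrays -/

/-- A `[K', F', Z', S]` placement delivery array with rows `ρ` and integers `σ`;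
the entry `none` is the star. -/
structure IsPDA {ρ σ : Type*} [Fintype ρ] [Fintype σ] {K' : ℕ} (B : ρ → Fin K' → Option σ)
    (F' Z' S : ℕ) : Prop where
  card_rows : Fintype.card ρ = F'
  card_integers : Fintype.card σ = S
  stars : ∀ k, {r | B r k = none}.ncard = Z'
  occurs : ∀ x : σ, ∃ r k, B r k = some x
  cross : ∀ (r₁ r₂ : ρ) (k₁ k₂ : Fin K') (x : σ), (r₁, k₁) ≠ (r₂, k₂) →
    B r₁ k₁ = some x → B r₂ k₂ = some x →
      r₁ ≠ r₂ ∧ k₁ ≠ k₂ ∧ B r₁ k₂ = none ∧ B r₂ k₁ = none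

/-- The rows `ψ r` of `P` and the columns of `P` in `I` (taken in increasing order) form a subarray
with the same star positions as `B`. Here `P f k` means that the entry `(f, k)` of `P` is a star. -/
def StarAligned {φ ρ σ : Type*} {K K' : ℕ} (P : φ → Fin K → Prop) (B : ρ → Fin K' → Option σ)
    (I : Finset (Fin K)) (hI : I.card = K') (ψ : ρ ↪ φ) : Prop :=
  ∀ r j, P (ψ r) (I.orderIsoOfFin hI j) ↔ B r j = none

/-- `(P, B)` is a `(K, K', F, F', Z, Z', S)` hotplug placement delivery array. -/
structure IsHpPDA {φ ρ σ : Type*} [Fintype φ] [Fintype ρ] [Fintype σ] {K K' : ℕ}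
    (P : φ → Fin K → Prop) (B : ρ → Fin K' → Option σ) (F F' Z Z' S : ℕ) : Prop where
  users : K' ≤ K
  rows : F' ≤ F
  memory : Z < F'
  card_rows : Fintype.card φ = F
  stars : ∀ k, {f | P f k}.ncard = Z
  pda : IsPDA B F' Z' S
  aligned : ∀ (I : Finset (Fin K)) (hI : I.card = K'), ∃ ψ : ρ ↪ φ, StarAligned P B I hI ψ

/-- A set `T` of integers whose transmissions may be dropped: each column of `B` contains at most
`Z - Z'` of them. -/
def IsRemovable {ρ σ : Type*} {K' : ℕ} (B : ρ → Fin K' → Option σ) (Z Z' : ℕ) (T : Finset σ) :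
    Prop :=
  ∀ k, {x | x ∈ T ∧ ∃ r, B r k = some x}.ncard + Z' ≤ Z

/-- `G` generates an MDS code: every square submatrix formed by as many columns as there are rows
is invertible. -/
def IsMDS {ρ φ 𝔽 : Type*} [Fintype ρ] [DecidableEq ρ] [Field 𝔽] (G : Matrix ρ φ 𝔽) : Prop :=
  ∀ e : ρ ↪ φ, (G.submatrix id e).det ≠ 0

/-- The coded subfile `C_{n, f}`. -/
def codedSubfile {ρ φ 𝔽 : Type*} [Fintype ρ] [Field 𝔽] {N : ℕ} (G : Matrix ρ φ 𝔽)
    (W : Fin N → ρ → 𝔽) (n : Fin N) (f : φ) : 𝔽 :=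
  ∑ r, G r f * W n r

/-- The hotplug coded caching scheme of a hotplug placement delivery array, with the transmissions
of the integers in `T` removed. Each file consists of subfiles in `𝔽` indexed by `ρ`. User `k`
stores the coded subfiles `C_{n, f}` with a star at `(f, k)`. For each integer `x ∉ T` the server
sends the sum of the coded subfiles `C_{d_k, f}` over all positions `(f, k)` of `x` in the array
obtained by placing `B` on the rows `ζ I` and the columns `I` of `P`. -/
def hpPDAScheme {φ ρ σ 𝔽 : Type*} [Fintype ρ] [DecidableEq σ] [Field 𝔽] {K K' : ℕ} (N : ℕ)
    (P : φ → Fin K → Prop) (B : ρ → Fin K' → Option σ)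
    (ζ : (I : Finset (Fin K)) → I.card = K' → (ρ ↪ φ)) (T : Finset σ) (G : Matrix ρ φ 𝔽) :
    HotplugScheme K K' N (ρ → 𝔽) (fun k => Fin N → {f : φ // P f k} → 𝔽)
      ({x : σ // x ∉ T} → 𝔽) where
  place _ W n f := codedSubfile G W n f.1
  deliver I hI d W x :=
    ∑ r : ρ, ∑ j : Fin K', if B r j = some x.1 then
      codedSubfile G W (d (I.orderIsoOfFin hI j)) (ζ I hI r) else 0

/-! ### Arrays from `t`-designs -/

/-- The family `blk` of blocks, repetitions being allowed, is a `t`-`(v, k, lam)` design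
on the point set `Fin v`. -/
structure IsTDesign {β : Type*} (t v k lam : ℕ) (blk : β → Finset (Fin v)) : Prop where
  t_pos : 0 < t
  lam_pos : 0 < lam
  t_le : t ≤ k
  k_lt : k < v
  card_block : ∀ i, (blk i).card = k
  balanced : ∀ Y : Finset (Fin v), Y.card = t → {i | Y ⊆ blk i}.ncard = lam

/-- The transposed incidence matrix of a design. -/
def designArray {β : Type*} {v : ℕ} (blk : β → Finset (Fin v)) (i : β) (x : Fin v) : Prop :=
  x ∈ blk i

/-- The row indices `(Y, i)` with `Y ⊆ [t]`, `1 ≤ |Y| ≤ t - 1` and `i ∈ [a_{|Y|}]`. -/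
abbrev TRow (t : ℕ) (a : ℕ → ℕ) : Type :=
  Σ Y : {Y : Finset (Fin t) // 1 ≤ Y.card ∧ Y.card < t}, Fin (a Y.1.card)

/-- The integers `(Y', i)` with `Y' ⊆ [t]`, `|Y'| = s + 1` for some `1 ≤ s ≤ t - 1`, and
`i ∈ [a_s]`. -/
abbrev TLabel (t : ℕ) (a : ℕ → ℕ) : Type :=
  Σ Y : {Y : Finset (Fin t) // 2 ≤ Y.card}, Fin (a (Y.1.card - 1))

/-- The array with entry `*` at `((Y, i), j)` if `j ∈ Y`, and `(Y ∪ {j}, i)` otherwise. -/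
def tArray (t : ℕ) (a : ℕ → ℕ) (r : TRow t a) (j : Fin t) : Option (TLabel t a) :=
  if h : j ∈ r.1.1 then none
  else some ⟨⟨insert j r.1.1, by
      rw [Finset.card_insert_of_notMem h]; have := r.1.2.1; omega⟩,
    Fin.cast (by simp [Finset.card_insert_of_notMem h]) r.2⟩

/-- The multiplicities `a_1, a_2` for `t = 3`. -/
def levels (a₁ a₂ : ℕ) : ℕ → ℕ := fun s => if s = 1 then a₁ else if s = 2 then a₂ else 0

/-! ### Correctness of the scheme of a hotplug placement delivery array -/

/-! Correctness is a count. By the MDS property, any F' coded subfiles determine a file. An active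
user caches Z of them and decodes one more for each transmitted integer in its column of B, because
the cross condition makes all other summands cached. A column has F' - Z' integers, of which at most
Z - Z' are dropped, so at least F' - Z new subfiles arrive.

For a 3-(K,4,3) design, inclusion-exclusion shows that C(K-4,2) blocks meet a triple exactly in a
given point, and 3(K-4)/2 exactly in a given pair. These are the bounds on a₁ and a₂, so the rows of
B embed into the blocks with the right star pattern. Dropping all integers on pairs and a of those
on [3] removes 2a₁ + a = Z - Z' integers per column and leaves a₂ - a transmissions. The design
itself consists of the unions of two edges within a factor of a one-factorization of the complete
graph on K points.

Conversely, one cache together with the transmissions for N constant demands determines all files,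
so R ≥ 1 - M/N. This is the term s = 1 of the cut-set bound, and it dominates because M/N ≥ 2/3. -/

theorem exists_decoder_of_determined {Ω α β γ : Type*} [Nonempty γ] (f : Ω → α) (g : Ω → β)
    (w : Ω → γ) (h : ∀ x y, f x = f y → g x = g y → w x = w y) :
    ∃ dec : α → β → γ, ∀ x, dec (f x) (g x) = w x := by
  classical
  -- Decode through any compatible preimage; pairs that never arise get an arbitrary value.
  refine ⟨fun p q => if h : ∃ x, f x = p ∧ g x = q then w h.choose else Classical.arbitrary γ,
    fun x => ?_⟩
  have hx : ∃ y, f y = f x ∧ g y = g x := ⟨x, rfl, rfl⟩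
  simp only [dif_pos hx]
  exact h _ _ hx.choose_spec.1 hx.choose_spec.2

/-- A file is determined by the coded subfiles in as many positions as it has subfiles. -/
theorem IsMDS.eq_of_codedSubfile_eq {ρ φ 𝔽 : Type*} [Fintype ρ] [DecidableEq ρ] [Field 𝔽] {N : ℕ}
    {G : Matrix ρ φ 𝔽} (hG : IsMDS G) {W W' : Fin N → ρ → 𝔽} {n : Fin N} {s : Finset φ}
    (hs : Fintype.card ρ ≤ s.card)
    (h : ∀ f ∈ s, codedSubfile G W n f = codedSubfile G W' n f) : W n = W' n := by
  obtain ⟨e⟩ : Nonempty (ρ ↪ s) := by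
    rw [Function.Embedding.nonempty_iff_card_le]
    simpa using hs
  have hdet := hG (e.trans (Function.Embedding.subtype _))
  rw [← Matrix.det_transpose] at hdet
  have := Matrix.eq_zero_of_mulVec_eq_zero hdet (v := W n - W' n) (by
    ext r
    have hr := h (e r) (e r).2
    simp only [codedSubfile] at hr
    simp [Matrix.mulVec, dotProduct, mul_sub, Finset.sum_sub_distrib, hr])
  exact sub_eq_zero.mp this

theorem IsPDA.injOn_column {ρ σ : Type*} [Fintype ρ] [Fintype σ] {K' F' Z' S : ℕ}
    {B : ρ → Fin K' → Option σ} (h : IsPDA B F' Z' S) {r₁ r₂ : ρ} {k : Fin K'} {x : σ}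
    (h₁ : B r₁ k = some x) (h₂ : B r₂ k = some x) : r₁ = r₂ := by
  by_contra hne
  exact (h.cross r₁ r₂ k k x (by simpa using hne) h₁ h₂).2.1 rfl

/-- In each column, at least `F' - Z` integers are transmitted. -/
theorem IsPDA.le_card_transmitted {ρ σ : Type*} [Fintype ρ] [Fintype σ]
    {K' F' Z Z' S : ℕ} {B : ρ → Fin K' → Option σ} (h : IsPDA B F' Z' S) {T : Finset σ}
    (hT : IsRemovable B Z Z' T) (k : Fin K') :
    F' ≤ Z + {r | ∃ x, x ∉ T ∧ B r k = some x}.ncard := by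
  classical
  have hcover : (Set.univ : Set ρ) = {r | B r k = none} ∪ {r | ∃ x, x ∈ T ∧ B r k = some x} ∪
      {r | ∃ x, x ∉ T ∧ B r k = some x} := by
    ext r
    rcases hr : B r k with _ | x
    · simp [hr]
    · by_cases hx : x ∈ T <;> simp [hr, hx]
  have hremoved : {r | ∃ x, x ∈ T ∧ B r k = some x}.ncard ≤
      {x | x ∈ T ∧ ∃ r, B r k = some x}.ncard := by
    rw [← Set.ncard_image_of_injective _ (Option.some_injective σ)]
    refine Set.ncard_le_ncard_of_injOn (fun r => B r k) ?_ ?_ (Set.toFinite _)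
    · rintro r ⟨x, hx, hr⟩
      exact ⟨x, ⟨hx, r, hr⟩, hr.symm⟩
    · rintro r ⟨x, -, hr⟩ r' - heq
      exact h.injOn_column hr (heq.symm.trans hr)
  have hcard : (Set.univ : Set ρ).ncard = F' := by
    rw [Set.ncard_univ, Nat.card_eq_fintype_card, h.card_rows]
  have h₁ := h.stars k
  have h₂ := hT k
  have h₃ := Set.ncard_union_le ({r | B r k = none} ∪ {r | ∃ x, x ∈ T ∧ B r k = some x})
    {r | ∃ x, x ∉ T ∧ B r k = some x}
  have h₄ := Set.ncard_union_le {r | B r k = none} {r | ∃ x, x ∈ T ∧ B r k = some x}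
  rw [← hcover, hcard] at h₃
  omega

/-- The improved scheme of a hotplug placement delivery array is correct. -/
theorem hpPDAScheme_correct {φ ρ σ 𝔽 : Type*} [Fintype φ] [Fintype ρ] [Fintype σ] [DecidableEq ρ]
    [DecidableEq σ] [Field 𝔽] {K K' F F' Z Z' S N : ℕ} {P : φ → Fin K → Prop}
    {B : ρ → Fin K' → Option σ} (h : IsHpPDA P B F F' Z Z' S) {T : Finset σ}
    (hT : IsRemovable B Z Z' T) {G : Matrix ρ φ 𝔽} (hG : IsMDS G)
    {ζ : (I : Finset (Fin K)) → I.card = K' → (ρ ↪ φ)}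
    (hζ : ∀ I hI, StarAligned P B I hI (ζ I hI)) :
    (hpPDAScheme N P B ζ T G).Correct := by
  classical
  intro I hI d k
  refine exists_decoder_of_determined _ _ (fun W : Fin N → ρ → 𝔽 => W (d k))
    fun W W' hplace hdeliver => ?_
  obtain ⟨j, rfl⟩ := (I.orderIsoOfFin hI).surjective k
  set k := I.orderIsoOfFin hI j
  have hcached : ∀ n f, P f k → codedSubfile G W n f = codedSubfile G W' n f :=
    fun n f hf => congrFun (congrFun hplace n) ⟨f, hf⟩
  -- Isolate the summand at (r, j). At any other position (r', j') of x the cross condition puts a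
  -- star at (r', j), so that summand is cached and cancels.
  have hsent : ∀ r x, x ∉ T → B r j = some x →
      codedSubfile G W (d k) (ζ I hI r) = codedSubfile G W' (d k) (ζ I hI r) := by
    intro r x hx hr
    have hsum := congrFun hdeliver ⟨x, hx⟩
    simp only [hpPDAScheme, ← Fintype.sum_prod_type'
      (f := fun r j => if B r j = some x then
        codedSubfile G _ (d (I.orderIsoOfFin hI j)) (ζ I hI r) else 0)] at hsum
    rw [← Finset.add_sum_erase _ _ (Finset.mem_univ (r, j)),
      ← Finset.add_sum_erase _ _ (Finset.mem_univ (r, j))] at hsum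
    rw [Finset.sum_congr rfl (g := fun p : ρ × Fin K' => if B p.1 p.2 = some x then
        codedSubfile G W' (d (I.orderIsoOfFin hI p.2)) (ζ I hI p.1) else 0)] at hsum
    · simp only [hr, if_true] at hsum
      exact add_right_cancel hsum
    · rintro ⟨r', j'⟩ hp
      by_cases hr' : B r' j' = some x
      · simp only [hr', if_true]
        refine hcached _ _ ((hζ I hI r' j).2 ?_)
        exact (h.pda.cross r r' j j' x (Finset.ne_of_mem_erase hp).symm hr hr').2.2.2
      · simp [hr']
  let cached : Finset φ := {f | P f k}
  let sent : Finset ρ := {r | ∃ x, x ∉ T ∧ B r j = some x}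
  -- Decoded subfiles lie at non-stars of the user's column, so they are new, and the counts Z and
  -- at least F' - Z add up.
  have hdisj : Disjoint cached (sent.map (ζ I hI)) := by
    rw [Finset.disjoint_left]
    intro f hf hf'
    obtain ⟨r, hr, rfl⟩ := Finset.mem_map.mp hf'
    obtain ⟨x, -, hx⟩ := (Finset.mem_filter.mp hr).2
    have := (hζ I hI r j).1 (Finset.mem_filter.mp hf).2
    simp [hx] at this
  refine hG.eq_of_codedSubfile_eq (s := cached ∪ sent.map (ζ I hI)) ?_ ?_
  · rw [Finset.card_union_of_disjoint hdisj, Finset.card_map, h.pda.card_rows]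
    have h₁ := h.stars k
    have h₂ := h.pda.le_card_transmitted hT j
    rw [Set.ncard_eq_toFinset_card', Set.toFinset_ofPred] at h₁ h₂
    simp only [cached, sent]
    convert h₂
  · intro f hf
    rcases Finset.mem_union.mp hf with hf | hf
    · exact hcached _ _ (Finset.mem_filter.mp hf).2
    · obtain ⟨r, hr, rfl⟩ := Finset.mem_map.mp hf
      obtain ⟨x, hxT, hx⟩ := (Finset.mem_filter.mp hr).2
      exact hsent r x hxT hx

/-- The Reed-Solomon code: evaluation at distinct points makes every maximal square submatrix a
transposed Vandermonde matrix. -/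
theorem exists_isMDS {ρ φ 𝔽 : Type*} [Fintype ρ] [DecidableEq ρ] [Fintype φ] [Field 𝔽] [Fintype 𝔽]
    (h : Fintype.card φ ≤ Fintype.card 𝔽) : ∃ G : Matrix ρ φ 𝔽, IsMDS G := by
  obtain ⟨α⟩ : Nonempty (φ ↪ 𝔽) := Function.Embedding.nonempty_of_card_le h
  let e := Fintype.equivFin ρ
  refine ⟨Matrix.of fun r f => α f ^ (e r : ℕ), fun ψ => ?_⟩
  have hinj : Function.Injective fun i => α (ψ (e.symm i)) :=
    α.injective.comp (ψ.injective.comp e.symm.injective)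
  have hdet := Matrix.det_vandermonde_ne_zero_iff.mpr hinj
  rw [← Matrix.det_transpose, ← Matrix.det_submatrix_equiv_self e] at hdet
  convert hdet using 2
  ext r r'
  simp [Matrix.vandermonde]

/-! ### The array of the `t`-scheme -/

theorem tArray_eq_none_iff {t : ℕ} {a : ℕ → ℕ} {r : TRow t a} {j : Fin t} :
    tArray t a r j = none ↔ j ∈ r.1.1 := by
  unfold tArray
  split_ifs with h <;> simp [h]

theorem tArray_eq_some_iff {t : ℕ} {a : ℕ → ℕ} {r : TRow t a} {j : Fin t} {x : TLabel t a} :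
    tArray t a r j = some x ↔ j ∉ r.1.1 ∧ x.1.1 = insert j r.1.1 ∧ (x.2 : ℕ) = r.2 := by
  obtain ⟨⟨Y, hY⟩, i⟩ := x
  unfold tArray
  split_ifs with h
  · simp [h]
  · simp only [Option.some.injEq, h, not_false_eq_true, true_and]
    constructor
    · intro heq
      cases heq
      simp
    · rintro ⟨rfl, hi⟩
      congr 1
      exact Fin.ext (by simpa using hi.symm)

theorem TRow.ext_val {t : ℕ} {a : ℕ → ℕ} {r s : TRow t a} (h : r.1.1 = s.1.1)
    (h' : (r.2 : ℕ) = s.2) : r = s := by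
  obtain ⟨⟨Y, hY⟩, i⟩ := r
  obtain ⟨⟨Y', hY'⟩, i'⟩ := s
  obtain rfl : Y = Y' := h
  congr 1
  exact Fin.ext h'

theorem exists_tArray_eq_some_iff {t : ℕ} {a : ℕ → ℕ} {j : Fin t} {x : TLabel t a} :
    (∃ r, tArray t a r j = some x) ↔ j ∈ x.1.1 := by
  constructor
  · rintro ⟨r, hr⟩
    rw [(tArray_eq_some_iff.mp hr).2.1]
    exact Finset.mem_insert_self _ _
  · intro hj
    obtain ⟨⟨Y, hY⟩, i⟩ := x
    have hcard : (Y.erase j).card = Y.card - 1 := Finset.card_erase_of_mem hj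
    have hle : Y.card ≤ t := by simpa using Finset.card_le_univ Y
    exact ⟨⟨⟨Y.erase j, by omega, by omega⟩, Fin.cast (by rw [hcard]) i⟩,
      tArray_eq_some_iff.mpr ⟨Finset.notMem_erase _ _, (Finset.insert_erase hj).symm, rfl⟩⟩

/-- If Y₁ ∪ {k₁} = Y₂ ∪ {k₂} with each kᵢ outside Yᵢ, then either k₁ = k₂ and the rows agree, or k₂
∈ Y₁ and k₁ ∈ Y₂, which are the two stars. -/
theorem tArray_cross {t : ℕ} {a : ℕ → ℕ} (r₁ r₂ : TRow t a) (k₁ k₂ : Fin t) (x : TLabel t a)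
    (hne : (r₁, k₁) ≠ (r₂, k₂)) (h₁ : tArray t a r₁ k₁ = some x) (h₂ : tArray t a r₂ k₂ = some x) :
    r₁ ≠ r₂ ∧ k₁ ≠ k₂ ∧ tArray t a r₁ k₂ = none ∧ tArray t a r₂ k₁ = none := by
  rw [tArray_eq_some_iff] at h₁ h₂
  simp only [tArray_eq_none_iff]
  obtain ⟨hk₁, hY₁, hi₁⟩ := h₁
  obtain ⟨hk₂, hY₂, hi₂⟩ := h₂
  have hk : k₁ ≠ k₂ := by
    rintro rfl
    refine hne (Prod.ext (TRow.ext_val ?_ (hi₁.symm.trans hi₂)) rfl)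
    rw [← Finset.erase_insert hk₁, ← Finset.erase_insert hk₂, ← hY₁, ← hY₂]
  have hmem₂ : k₂ ∈ r₁.1.1 := by
    have : k₂ ∈ insert k₁ r₁.1.1 := hY₁ ▸ hY₂ ▸ Finset.mem_insert_self _ _
    exact (Finset.mem_insert.mp this).resolve_left hk.symm
  have hmem₁ : k₁ ∈ r₂.1.1 := by
    have : k₁ ∈ insert k₂ r₂.1.1 := hY₂ ▸ hY₁ ▸ Finset.mem_insert_self _ _
    exact (Finset.mem_insert.mp this).resolve_left hk
  exact ⟨fun h => hk₁ (h ▸ hmem₁), hk, hmem₂, hmem₁⟩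

theorem sum_rowSupports (g : Finset (Fin 3) → ℕ) :
    ∑ Y : {Y : Finset (Fin 3) // 1 ≤ Y.card ∧ Y.card < 3}, g Y.1 =
      g {0} + g {1} + g {2} + g {0, 1} + g {0, 2} + g {1, 2} := by
  rw [← Finset.sum_subtype (p := fun Y : Finset (Fin 3) => 1 ≤ Y.card ∧ Y.card < 3)
    {{0}, {1}, {2}, {0, 1}, {0, 2}, {1, 2}} (by decide)]
  repeat rw [Finset.sum_insert (by decide)]
  rw [Finset.sum_singleton]
  ring

theorem sum_labelSupports (g : Finset (Fin 3) → ℕ) :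
    ∑ Y : {Y : Finset (Fin 3) // 2 ≤ Y.card}, g Y.1 =
      g {0, 1} + g {0, 2} + g {1, 2} + g Finset.univ := by
  rw [← Finset.sum_subtype (p := fun Y : Finset (Fin 3) => 2 ≤ Y.card)
    {{0, 1}, {0, 2}, {1, 2}, Finset.univ} (by decide)]
  repeat rw [Finset.sum_insert (by decide)]
  rw [Finset.sum_singleton]
  ring

theorem card_filter_tRow (a : ℕ → ℕ) (p : Finset (Fin 3) → Prop) [DecidablePred p] :
    (Finset.univ.filter fun r : TRow 3 a => p r.1.1).card =
      ∑ Y : {Y : Finset (Fin 3) // 1 ≤ Y.card ∧ Y.card < 3},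
        if p Y.1 then a Y.1.card else 0 := by
  rw [Finset.card_filter, Fintype.sum_sigma]
  exact Finset.sum_congr rfl fun Y _ => by split_ifs <;> simp [*]

theorem card_filter_tLabel (a : ℕ → ℕ) (p : Finset (Fin 3) → ℕ → Prop) [∀ Y, DecidablePred (p Y)] :
    (Finset.univ.filter fun x : TLabel 3 a => p x.1.1 x.2).card =
      ∑ Y : {Y : Finset (Fin 3) // 2 ≤ Y.card},
        ((Finset.range (a (Y.1.card - 1))).filter (p Y.1)).card := by
  rw [Finset.card_filter, Fintype.sum_sigma]
  refine Finset.sum_congr rfl fun Y _ => ?_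
  rw [Finset.card_filter, ← Fin.sum_univ_eq_sum_range (fun i => if p Y.1 i then 1 else 0)]

theorem tArray_isPDA (a₁ a₂ : ℕ) :
    IsPDA (tArray 3 (levels a₁ a₂)) (3 * (a₁ + a₂)) (a₁ + 2 * a₂) (3 * a₁ + a₂) where
  card_rows := by
    simp only [Fintype.card_sigma, Fintype.card_fin]
    rw [sum_rowSupports (fun Y => levels a₁ a₂ Y.card)]
    simp [levels]
    ring
  card_integers := by
    simp only [Fintype.card_sigma, Fintype.card_fin]
    rw [sum_labelSupports (fun Y => levels a₁ a₂ (Y.card - 1))]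
    simp [levels]
    ring
  stars k := by
    simp only [tArray_eq_none_iff]
    rw [Set.ncard_eq_toFinset_card', Set.toFinset_ofPred,
      card_filter_tRow _ (fun Y => k ∈ Y),
      sum_rowSupports (fun Y => if k ∈ Y then levels a₁ a₂ Y.card else 0)]
    fin_cases k <;> simp [levels] <;> ring
  occurs x := by
    obtain ⟨j, hj⟩ : x.1.1.Nonempty := Finset.card_pos.mp (by have := x.1.2; omega)
    obtain ⟨r, hr⟩ := exists_tArray_eq_some_iff.mpr hj
    exact ⟨r, j, hr⟩
  cross := tArray_cross

/-- All integers `(Y, i)` with `|Y| = 2`, and those with `|Y| = 3` and `i < a`. -/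
def removedLabels (a₁ a₂ a : ℕ) : Finset (TLabel 3 (levels a₁ a₂)) :=
  {x | x.1.1.card = 2 ∨ (x.2 : ℕ) < a}

theorem filter_range_lt {m n : ℕ} (h : m ≤ n) :
    (Finset.range n).filter (· < m) = Finset.range m := by
  ext i
  simp only [Finset.mem_filter, Finset.mem_range]
  omega

theorem card_removedLabels {a₁ a₂ a : ℕ} (h : a ≤ a₂) :
    (removedLabels a₁ a₂ a).card = 3 * a₁ + a := by
  rw [removedLabels, card_filter_tLabel _ (fun Y i => Y.card = 2 ∨ i < a),
    sum_labelSupports (fun Y => ((Finset.range (levels a₁ a₂ (Y.card - 1))).filter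
      (fun i => Y.card = 2 ∨ i < a)).card)]
  simp [levels, filter_range_lt h]
  ring

/-- Each k lies in two of the three pairs and in the full set, so its column loses 2a₁ + a integers,
exactly Z - Z'. -/
theorem removedLabels_isRemovable {a₁ a₂ a Z : ℕ} (h : a ≤ a₂) (hZ : Z = a + 3 * a₁ + 2 * a₂) :
    IsRemovable (tArray 3 (levels a₁ a₂)) Z (a₁ + 2 * a₂) (removedLabels a₁ a₂ a) := by
  intro k
  suffices {x | x ∈ removedLabels a₁ a₂ a ∧
      ∃ r, tArray 3 (levels a₁ a₂) r k = some x}.ncard = 2 * a₁ + a by omega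
  simp only [exists_tArray_eq_some_iff, removedLabels, Finset.mem_filter, Finset.mem_univ, true_and]
  rw [Set.ncard_eq_toFinset_card', Set.toFinset_ofPred,
    card_filter_tLabel _ (fun Y i => (Y.card = 2 ∨ i < a) ∧ k ∈ Y),
    sum_labelSupports (fun Y => ((Finset.range (levels a₁ a₂ (Y.card - 1))).filter
      (fun i => (Y.card = 2 ∨ i < a) ∧ k ∈ Y)).card)]
  fin_cases k <;> simp [levels, filter_range_lt h] <;> ring

/-! ### Block counts of designs -/

/-- The number of blocks that contain a given set of points. -/
def blockDegree {β : Type*} [Fintype β] {v : ℕ} (blk : β → Finset (Fin v)) (Y : Finset (Fin v)) :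
    ℕ :=
  (Finset.univ.filter fun i => Y ⊆ blk i).card

/-- Double counting of pairs of a block containing Y and a point z of it outside Y. Applied
downwards from triples, it gives the degrees of pairs and points. -/
theorem sum_blockDegree_insert {β : Type*} [Fintype β] {v k : ℕ} {blk : β → Finset (Fin v)}
    (hk : ∀ i, (blk i).card = k) (Y : Finset (Fin v)) :
    ∑ z ∈ Yᶜ, blockDegree blk (insert z Y) = (k - Y.card) * blockDegree blk Y := by
  simp only [blockDegree, Finset.card_filter]
  rw [Finset.sum_comm, Finset.mul_sum]
  refine Finset.sum_congr rfl fun i _ => ?_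
  by_cases h : Y ⊆ blk i
  · simp only [Finset.insert_subset_iff, h, and_true, if_true, mul_one]
    rw [← Finset.card_filter, ← hk i, ← Finset.card_sdiff_of_subset h]
    congr 1
    ext z
    simp [and_comm]
  · simp [Finset.insert_subset_iff, h]

namespace IsTDesign

variable {b K : ℕ} {blk : Fin b → Finset (Fin K)}

theorem blockDegree_triple (h : IsTDesign 3 K 4 3 blk) {Y : Finset (Fin K)} (hY : Y.card = 3) :
    blockDegree blk Y = 3 := by
  have := h.balanced Y hY
  rwa [Set.ncard_eq_toFinset_card', Set.toFinset_ofPred] at this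

theorem blockDegree_pair (h : IsTDesign 3 K 4 3 blk) {Y : Finset (Fin K)} (hY : Y.card = 2) :
    2 * blockDegree blk Y = 3 * (K - 2) := by
  have hsum := sum_blockDegree_insert h.card_block Y
  rw [hY, Finset.sum_congr rfl (g := fun _ => 3), Finset.sum_const, Finset.card_compl, hY,
    Fintype.card_fin, smul_eq_mul] at hsum
  · omega
  · intro z hz
    exact h.blockDegree_triple (by
      rw [Finset.card_insert_of_notMem (Finset.mem_compl.mp hz), hY])

theorem blockDegree_singleton (h : IsTDesign 3 K 4 3 blk) (x : Fin K) :
    blockDegree blk {x} = (K - 1).choose 2 := by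
  have hsum := sum_blockDegree_insert h.card_block {x}
  have hsum' : ∑ z ∈ ({x} : Finset (Fin K))ᶜ, 2 * blockDegree blk (insert z {x}) =
      (K - 1) * (3 * (K - 2)) := by
    rw [Finset.sum_congr rfl (g := fun _ => 3 * (K - 2)), Finset.sum_const, Finset.card_compl,
      Finset.card_singleton, Fintype.card_fin, smul_eq_mul]
    intro z hz
    exact h.blockDegree_pair (by
      rw [Finset.card_insert_of_notMem (Finset.mem_compl.mp hz), Finset.card_singleton])
  rw [← Finset.mul_sum, hsum, Finset.card_singleton] at hsum'
  rw [Nat.choose_two_right, Nat.sub_sub, show 1 + 1 = 2 from rfl]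
  have : (K - 1) * (3 * (K - 2)) = 3 * ((K - 1) * (K - 2)) := by ring
  omega

/-- Blocks through two points that avoid a third one. -/
theorem two_mul_card_pair_avoiding (h : IsTDesign 3 K 4 3 blk) {x y z : Fin K} (hxy : x ≠ y)
    (hxz : x ≠ z) (hyz : y ≠ z) :
    2 * (Finset.univ.filter fun i => x ∈ blk i ∧ y ∈ blk i ∧ z ∉ blk i).card + 6 =
      3 * (K - 2) := by
  have h₂ := h.blockDegree_pair (Finset.card_pair hxy)
  have h₃ := h.blockDegree_triple (Finset.card_eq_three.mpr ⟨x, y, z, hxy, hxz, hyz, rfl⟩)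
  have hsplit := Finset.card_filter_add_card_filter_not
    (s := Finset.univ.filter fun i => {x, y} ⊆ blk i) (fun i => z ∈ blk i)
  simp only [Finset.filter_filter] at hsplit
  simp only [blockDegree, Finset.insert_subset_iff, Finset.singleton_subset_iff, and_assoc]
    at h₂ h₃ hsplit
  omega

/-- Blocks through a point that avoid two others. -/
theorem card_singleton_avoiding (h : IsTDesign 3 K 4 3 blk) {x y z : Fin K} (hxy : x ≠ y)
    (hxz : x ≠ z) (hyz : y ≠ z) :
    (Finset.univ.filter fun i => x ∈ blk i ∧ y ∉ blk i ∧ z ∉ blk i).card + 3 * (K - 2) =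
      (K - 1).choose 2 + 3 := by
  -- From the blocks through x remove those through z, then those through y but not z.
  have h₁ := h.blockDegree_singleton x
  have h₂ := h.blockDegree_pair (Finset.card_pair hxz)
  have h₂' := h.two_mul_card_pair_avoiding hxy hxz hyz
  have h₁₁ := Finset.card_filter_add_card_filter_not
    (s := Finset.univ.filter fun i => x ∈ blk i) (fun i => z ∈ blk i)
  have h₁₂ := Finset.card_filter_add_card_filter_not
    (s := Finset.univ.filter fun i => x ∈ blk i ∧ z ∉ blk i) (fun i => y ∈ blk i)
  simp only [Finset.filter_filter] at h₁₁ h₁₂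
  simp only [blockDegree, Finset.insert_subset_iff, Finset.singleton_subset_iff] at h₁ h₂
  have e₁ : (Finset.univ.filter fun i => (x ∈ blk i ∧ z ∉ blk i) ∧ y ∈ blk i) =
      Finset.univ.filter fun i => x ∈ blk i ∧ y ∈ blk i ∧ z ∉ blk i := by
    ext; simp; tauto
  have e₂ : (Finset.univ.filter fun i => (x ∈ blk i ∧ z ∉ blk i) ∧ y ∉ blk i) =
      Finset.univ.filter fun i => x ∈ blk i ∧ y ∉ blk i ∧ z ∉ blk i := by
    ext; simp; tauto
  rw [e₁, e₂] at h₁₂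
  omega

end IsTDesign

/-- Up to relabelling the three columns, a row support is a point or a pair, so two block counts
suffice. -/
theorem Fin.three_finset_cases (Y : Finset (Fin 3)) (h : 1 ≤ Y.card ∧ Y.card < 3) :
    ∃ p q r : Fin 3, p ≠ q ∧ p ≠ r ∧ q ≠ r ∧ (∀ s, s = p ∨ s = q ∨ s = r) ∧
      (Y = {p} ∨ Y = {p, q}) := by
  revert Y
  decide

theorem IsTDesign.le_card_pattern {b K a₁ a₂ : ℕ} {blk : Fin b → Finset (Fin K)}
    (h : IsTDesign 3 K 4 3 blk) (hK : 6 ≤ K) (ha₁ : a₁ ≤ (K - 4).choose 2)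
    (ha₂ : 2 * a₂ ≤ 3 * (K - 4)) (e : Fin 3 ↪ Fin K) (Y : Finset (Fin 3))
    (hY : 1 ≤ Y.card ∧ Y.card < 3) :
    levels a₁ a₂ Y.card ≤ Fintype.card {i // ∀ j, e j ∈ blk i ↔ j ∈ Y} := by
  obtain ⟨p, q, r, hpq, hpr, hqr, hall, hcase⟩ := Fin.three_finset_cases Y hY
  have key : ∀ s : Fin 3 → Prop, (∀ j, s j) ↔ s p ∧ s q ∧ s r := fun s =>
    ⟨fun hs => ⟨hs p, hs q, hs r⟩, fun hs j => by rcases hall j with rfl | rfl | rfl <;> tauto⟩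
  rw [Fintype.card_subtype]
  simp only [key]
  rcases hcase with rfl | rfl
  · have := h.card_singleton_avoiding (e.injective.ne hpq) (e.injective.ne hpr)
      (e.injective.ne hqr)
    simp only [Finset.mem_singleton, hpq.symm, hpr.symm, iff_true, iff_false, levels,
      Finset.card_singleton, if_true]
    obtain ⟨n, rfl⟩ : ∃ n, K = n + 4 := ⟨K - 4, by omega⟩
    -- This turns C(K-1,2) - 3(K-2) + 3 into C(K-4,2).
    have hch : (n + 4 - 1).choose 2 = n.choose 2 + 3 * n + 3 := by
      simp [Nat.choose_succ_succ']
      ring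
    rw [Nat.add_sub_cancel] at ha₁
    omega
  · have := h.two_mul_card_pair_avoiding (e.injective.ne hpq) (e.injective.ne hpr)
      (e.injective.ne hqr)
    simp only [Finset.mem_insert, Finset.mem_singleton, hpq, hpq.symm, hpr.symm, hqr.symm, iff_true,
      iff_false, levels, Finset.card_pair hpq, or_false, or_true, if_true]
    norm_num
    omega

/-- Rows with support Y go injectively to blocks whose trace on I is Y. Different traces force
different blocks, so these injections glue. -/
theorem IsTDesign.exists_starAligned {b K a₁ a₂ : ℕ} {blk : Fin b → Finset (Fin K)}
    (h : IsTDesign 3 K 4 3 blk) (hK : 6 ≤ K) (ha₁ : a₁ ≤ (K - 4).choose 2)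
    (ha₂ : 2 * a₂ ≤ 3 * (K - 4)) (I : Finset (Fin K)) (hI : I.card = 3) :
    ∃ ψ : TRow 3 (levels a₁ a₂) ↪ Fin b,
      StarAligned (designArray blk) (tArray 3 (levels a₁ a₂)) I hI ψ := by
  let e : Fin 3 ↪ Fin K := (I.orderIsoOfFin hI).toEmbedding.trans
    (Function.Embedding.subtype _)
  have hemb : ∀ Y : {Y : Finset (Fin 3) // 1 ≤ Y.card ∧ Y.card < 3},
      Nonempty (Fin (levels a₁ a₂ Y.1.card) ↪ {i // ∀ j, e j ∈ blk i ↔ j ∈ Y.1}) := fun Y => by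
    rw [Function.Embedding.nonempty_iff_card_le, Fintype.card_fin]
    exact h.le_card_pattern hK ha₁ ha₂ e Y.1 Y.2
  let g := fun Y => (hemb Y).some
  have hg : ∀ (r : TRow 3 (levels a₁ a₂)) j, e j ∈ blk (g r.1 r.2) ↔ j ∈ r.1.1 :=
    fun r => (g r.1 r.2).2
  refine ⟨⟨fun r => (g r.1 r.2).1, fun r s hrs => ?_⟩, fun r j => ?_⟩
  · have hY : r.1 = s.1 := Subtype.ext (Finset.ext fun j => by
      rw [← hg r j, ← hg s j]
      exact iff_of_eq (congrArg (fun i => e j ∈ blk i) hrs))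
    obtain ⟨Y, i⟩ := r
    obtain ⟨Y', i'⟩ := s
    obtain rfl : Y = Y' := hY
    exact congrArg _ ((g Y).injective (Subtype.ext hrs))
  · rw [tArray_eq_none_iff]
    exact hg r j

theorem IsTDesign.isHpPDA {b K a₁ a₂ a : ℕ} {blk : Fin b → Finset (Fin K)}
    (h : IsTDesign 3 K 4 3 blk) (hK : 6 ≤ K) (ha₁ : a₁ ≤ (K - 4).choose 2)
    (ha₂ : 2 * a₂ ≤ 3 * (K - 4)) (ha : a < a₂) (hsum : (K - 1).choose 2 = a + 3 * a₁ + 2 * a₂) :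
    IsHpPDA (designArray blk) (tArray 3 (levels a₁ a₂))
      b (3 * (a₁ + a₂)) ((K - 1).choose 2) (a₁ + 2 * a₂) (3 * a₁ + a₂) where
  users := by omega
  rows := by
    obtain ⟨I, hI⟩ : ∃ I : Finset (Fin K), I.card = 3 := by
      obtain ⟨I, -, hI⟩ := Finset.exists_subset_card_eq
        (s := (Finset.univ : Finset (Fin K))) (n := 3) (by simp; omega)
      exact ⟨I, hI⟩
    obtain ⟨ψ, -⟩ := h.exists_starAligned hK ha₁ ha₂ I hI
    rw [← (tArray_isPDA a₁ a₂).card_rows]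
    simpa using Fintype.card_le_of_embedding ψ
  -- Given the formula for Z, this is a < a₂.
  memory := by omega
  card_rows := Fintype.card_fin b
  stars k := by
    change {f | k ∈ blk f}.ncard = _
    rw [← h.blockDegree_singleton k, Set.ncard_eq_toFinset_card', Set.toFinset_ofPred]
    simp only [blockDegree, Finset.singleton_subset_iff]
  pda := tArray_isPDA a₁ a₂
  aligned := h.exists_starAligned hK ha₁ ha₂

/-! ### Existence of designs -/

/-- A one-factorization of the complete graph on `X`, given by the fixed point free involutions
that swap the ends of the edges of each factor. -/
structure IsOneFactorization {ι X : Type*} (f : ι → X → X) : Prop where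
  involutive : ∀ i, Function.Involutive (f i)
  existsUnique : ∀ x y, x ≠ y → ∃! i, f i x = y
  ne_self : ∀ i x, f i x ≠ x

theorem IsOneFactorization.conj {ι X X' : Type*} {f : ι → X → X} (h : IsOneFactorization f)
    (e : X ≃ X') : IsOneFactorization fun i x => e (f i (e.symm x)) where
  involutive i x := by simp [h.involutive i (e.symm x)]
  existsUnique x y hxy := by
    simpa [← Equiv.eq_symm_apply] using h.existsUnique (e.symm x) (e.symm y) (by simpa using hxy)
  ne_self i x := by simpa [← Equiv.eq_symm_apply] using h.ne_self i (e.symm x)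

/-- The reflections `x ↦ 2 i - x` of `ℤ/m`, with the fixed point `i` matched to `none`. -/
def reflection (m : ℕ) (i : ZMod m) : Option (ZMod m) → Option (ZMod m)
  | none => some i
  | some x => if x = i then none else some (2 * i - x)

/-- For odd m, 2 is invertible: the edge {x, y} lies only in the factor of the midpoint (x + y)/2,
and x ↦ 2i - x fixes only i. -/
theorem reflection_isOneFactorization {m : ℕ} (hm : Odd m) :
    IsOneFactorization (reflection m) := by
  have h2 : IsUnit (2 : ZMod m) := by
    have : Nat.Coprime 2 m := (Nat.coprime_two_left).mpr hm
    exact_mod_cast (ZMod.isUnit_iff_coprime 2 m).mpr this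
  have hcancel : ∀ x y : ZMod m, 2 * x = 2 * y → x = y := fun x y h => h2.mul_left_cancel h
  refine ⟨?_, ?_, ?_⟩
  · rintro i (_ | x)
    · simp [reflection]
    · by_cases hx : x = i
      · simp [reflection, hx]
      · have : 2 * i - x ≠ i := fun h => hx (by linear_combination -h)
        simp [reflection, hx, this]
  · rintro (_ | x) (_ | y) hxy
    · exact absurd rfl hxy
    · exact ⟨y, by simp [reflection], fun i hi => by simpa [reflection] using hi⟩
    · refine ⟨x, by simp [reflection], fun i hi => ?_⟩
      by_contra hne
      simp [reflection, Ne.symm hne] at hi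
    · have hxy' : x ≠ y := fun h => hxy (congrArg some h)
      obtain ⟨i, hi⟩ := h2.dvd (a := x + y)
      refine ⟨i, ?_, fun i' hi' => ?_⟩
      · have : x ≠ i := fun h => hxy' (by linear_combination -hi + 2 * h)
        simp only [reflection, this, if_false, Option.some.injEq]
        linear_combination -hi
      · by_cases hx : x = i'
        · simp [reflection, hx] at hi'
        · simp only [reflection, hx, if_false, Option.some.injEq] at hi'
          exact hcancel _ _ (by linear_combination hi' + hi)
  · rintro i (_ | x)
    · simp [reflection]
    · by_cases hx : x = i
      · simp [reflection, hx]
      · simp only [reflection, hx, if_false, ne_eq, Option.some.injEq]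
        exact fun h => hx (hcancel _ _ (by linear_combination -h))

namespace IsOneFactorization

variable {ι : Type*} {v : ℕ} {f : ι → Fin v → Fin v}

/-- The `4`-sets that are unions of two edges of a factor. -/
abbrev Block (f : ι → Fin v → Fin v) : Type _ :=
  {p : ι × Finset (Fin v) // p.2.card = 4 ∧ ∀ x ∈ p.2, f p.1 x ∈ p.2}

/-- A union of two edges that contains three points is spanned by them and contains an edge
between two of them. -/
theorem eq_of_triple_subset (h : IsOneFactorization f) {i : ι} {A : Finset (Fin v)}
    (hA : A.card = 4) (hclosed : ∀ x ∈ A, f i x ∈ A) {x y z : Fin v} (hxy : x ≠ y) (hxz : x ≠ z)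
    (hyz : y ≠ z) (hx : x ∈ A) (hy : y ∈ A) (hz : z ∈ A) :
    (f i x = y ∧ A = {x, y, z, f i z}) ∨ (f i x = z ∧ A = {x, z, y, f i y}) ∨
      (f i y = z ∧ A = {y, z, x, f i x}) := by
  have hinv := h.involutive i
  have hne := h.ne_self i
  have hsub : {x, y, z} ⊆ A := by
    intro w
    simp only [Finset.mem_insert, Finset.mem_singleton]
    rintro (rfl | rfl | rfl) <;> assumption
  have h3 : ({x, y, z} : Finset (Fin v)).card = 3 :=
    Finset.card_eq_three.mpr ⟨x, y, z, hxy, hxz, hyz, rfl⟩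
  obtain ⟨w, hw⟩ : ∃ w, A \ {x, y, z} = {w} := by
    rw [← Finset.card_eq_one, Finset.card_sdiff_of_subset hsub, hA, h3]
  have hmem : ∀ u, u ∈ A ↔ u = x ∨ u = y ∨ u = z ∨ u = w := by
    intro u
    have := Finset.ext_iff.mp hw u
    simp only [Finset.mem_sdiff, Finset.mem_insert, Finset.mem_singleton] at this
    constructor
    · intro hu
      tauto
    · rintro (rfl | rfl | rfl | rfl)
      · exact hx
      · exact hy
      · exact hz
      · exact (this.mpr rfl).1
  have hw' : w ∉ ({x, y, z} : Finset (Fin v)) :=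
    (Finset.mem_sdiff.mp (hw ▸ Finset.mem_singleton_self w)).2
  simp only [Finset.mem_insert, Finset.mem_singleton, not_or] at hw'
  have hfx := (hmem _).mp (hclosed x hx)
  have hfy := (hmem _).mp (hclosed y hy)
  have hfz := (hmem _).mp (hclosed z hz)
  have hx' := hne x
  have hy' := hne y
  have hz' := hne z
  have hix := hinv x
  have hiy := hinv y
  have hiz := hinv z
  -- A fixed point free involution of four points is one of their three perfect matchings.
  have key : (f i x = y ∧ f i z = w) ∨ (f i x = z ∧ f i y = w) ∨ (f i y = z ∧ f i x = w) := by
    grind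
  have hA' : A = {x, y, z, w} := Finset.ext fun u => by
    simp only [hmem, Finset.mem_insert, Finset.mem_singleton]
  rcases key with ⟨h₁, h₂⟩ | ⟨h₁, h₂⟩ | ⟨h₁, h₂⟩
  · exact Or.inl ⟨h₁, by rw [hA', h₂]⟩
  · exact Or.inr (Or.inl ⟨h₁, by rw [hA', h₂, Finset.insert_comm y z]⟩)
  · exact Or.inr (Or.inr ⟨h₁, by rw [hA', h₂, Finset.insert_comm x y, Finset.insert_comm x z]⟩)

theorem exists_block (h : IsOneFactorization f) {i : ι} {x y z : Fin v} (hxy : x ≠ y) (hxz : x ≠ z)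
    (hyz : y ≠ z) (hi : f i x = y) :
    ∃ p : Block f, p.1 = (i, {x, y, z, f i z}) := by
  have hinv := h.involutive i
  have hiy : f i y = x := hi ▸ hinv x
  have hzx : f i z ≠ x := fun hz => hyz (by rw [← hi, ← hz, hinv])
  have hzy : f i z ≠ y := fun hz => hxz (by rw [← hiy, ← hz, hinv])
  refine ⟨⟨(i, {x, y, z, f i z}), ?_, ?_⟩, rfl⟩
  · have := h.ne_self i z
    rw [Finset.card_insert_of_notMem, Finset.card_insert_of_notMem, Finset.card_pair this.symm]
    · simp [hyz, hzy.symm]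
    · simp [hxy, hxz, hzx.symm]
  · intro w
    simp only [Finset.mem_insert, Finset.mem_singleton]
    rintro (rfl | rfl | rfl | rfl)
    · simp [hi]
    · simp [hiy]
    · simp
    · simp [hinv z]

/-- Each of the three pairs in a triple is an edge of a unique factor, and together with the
factor's edge at the third point it spans one block. Pairs sharing a point lie in different factors,
so the three indexed blocks differ even if their point sets coincide. -/
theorem isTDesign (h : IsOneFactorization f) (hv : 4 < v) :
    IsTDesign 3 v 4 3 fun p : Block f => p.1.2 where
  t_pos := by norm_num
  lam_pos := by norm_num
  t_le := by norm_num
  k_lt := hv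
  card_block p := p.2.1
  balanced Y hY := by
    obtain ⟨x, y, z, hxy, hxz, hyz, rfl⟩ := Finset.card_eq_three.mp hY
    obtain ⟨i, hi, hi'⟩ := h.existsUnique x y hxy
    obtain ⟨j, hj, hj'⟩ := h.existsUnique x z hxz
    obtain ⟨k, hk, hk'⟩ := h.existsUnique y z hyz
    obtain ⟨p, hp⟩ := h.exists_block hxy hxz hyz hi
    obtain ⟨q, hq⟩ := h.exists_block hxz hxy hyz.symm hj
    obtain ⟨r, hr⟩ := h.exists_block hyz hxy.symm hxz.symm hk
    have hij : i ≠ j := by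
      rintro rfl
      exact hyz (hi.symm.trans hj)
    have hjk : j ≠ k := by
      rintro rfl
      exact hxy ((h.involutive j).injective (hj.trans hk.symm))
    have hik : i ≠ k := by
      rintro rfl
      have := h.involutive i x
      rw [hi, hk] at this
      exact hxz this.symm
    have hpq : p ≠ q := fun e => hij (by simpa [hp, hq] using congrArg (fun p => p.1.1) e)
    have hqr : q ≠ r := fun e => hjk (by simpa [hr, hq] using congrArg (fun p => p.1.1) e)
    have hpr : p ≠ r := fun e => hik (by simpa [hp, hr] using congrArg (fun p => p.1.1) e)
    refine Set.ncard_eq_three.mpr ⟨p, q, r, hpq, hpr, hqr, ?_⟩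
    ext s
    simp only [Set.mem_ofPred_eq, Set.mem_insert_iff, Set.mem_singleton_iff, Subtype.ext_iff,
      hp, hq, hr, Finset.insert_subset_iff, Finset.singleton_subset_iff]
    constructor
    · rintro ⟨hx, hy, hz⟩
      rcases h.eq_of_triple_subset s.2.1 s.2.2 hxy hxz hyz hx hy hz with
        ⟨e, hA⟩ | ⟨e, hA⟩ | ⟨e, hA⟩
      · obtain rfl := hi' _ e
        exact Or.inl (Prod.ext rfl hA)
      · obtain rfl := hj' _ e
        exact Or.inr (Or.inl (Prod.ext rfl hA))
      · obtain rfl := hk' _ e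
        exact Or.inr (Or.inr (Prod.ext rfl hA))
    · rintro (e | e | e) <;> simp [e]

end IsOneFactorization

theorem IsTDesign.comp_equiv {β β' : Type*} {t v k lam : ℕ} {blk : β → Finset (Fin v)}
    (h : IsTDesign t v k lam blk) (e : β' ≃ β) : IsTDesign t v k lam (blk ∘ e) where
  t_pos := h.t_pos
  lam_pos := h.lam_pos
  t_le := h.t_le
  k_lt := h.k_lt
  card_block i := h.card_block (e i)
  balanced Y hY := by
    rw [← h.balanced Y hY, ← Set.ncard_preimage_of_injective_subset_range (f := e) e.injective
      (by simp [e.surjective.range_eq])]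
    rfl

theorem exists_isTDesign_of_even {K : ℕ} (hK : Even K) (h6 : 6 ≤ K) :
    ∃ (b : ℕ) (blk : Fin b → Finset (Fin K)), IsTDesign 3 K 4 3 blk := by
  classical
  have hodd : Odd (K - 1) := Nat.Even.sub_odd (by omega) hK odd_one
  have : NeZero (K - 1) := ⟨by omega⟩
  have e : Option (ZMod (K - 1)) ≃ Fin K := Fintype.equivFinOfCardEq (by
    rw [Fintype.card_option, ZMod.card]
    omega)
  have hf := (reflection_isOneFactorization hodd).conj e
  have hd := hf.isTDesign (by omega)
  exact ⟨_, _, hd.comp_equiv (Fintype.equivFin _).symm⟩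

/-! ### Achievability and the cut-set bound -/

/-- Files, caches and signals may be replaced by sets of at least the same size. -/
theorem HotplugScheme.Correct.exists_transport {K K' N : ℕ} {File File' : Type*}
    {Cache Cache' : Fin K → Type*} {Signal Signal' : Type*}
    {s : HotplugScheme K K' N File Cache Signal} (hs : s.Correct) (e : File' ≃ File)
    (f : ∀ k, Cache k ↪ Cache' k) (g : Signal ↪ Signal') [Nonempty File'] :
    ∃ s' : HotplugScheme K K' N File' Cache' Signal', s'.Correct := by
  refine ⟨⟨fun k W => f k (s.place k (e ∘ W)), fun I hI d W => g (s.deliver I hI d (e ∘ W))⟩,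
    fun I hI d k => ?_⟩
  obtain ⟨dec, hdec⟩ := hs I hI d k
  refine exists_decoder_of_determined _ _ (fun W : Fin N → File' => W (d k))
    fun W W' hp hd => ?_
  have h := hdec (e ∘ W)
  rw [(f k).injective hp, g.injective hd, hdec] at h
  exact e.injective h.symm

/-- A correct scheme over a field with `2 ^ m` elements makes its memory-rate pair achievable. -/
theorem HotplugScheme.Correct.achievable {K K' N m c l : ℕ} {ρ : Type*} [Fintype ρ] [Nonempty ρ]
    {χ : Fin K → Type*} {τ : Type*} [∀ k, Fintype (χ k)] [Fintype τ] {𝔽 : Type*} [Fintype 𝔽]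
    (hm : 0 < m) (h𝔽 : Fintype.card 𝔽 = 2 ^ m) (hχ : ∀ k, Fintype.card (χ k) = c)
    (hτ : Fintype.card τ = l)
    {s : HotplugScheme K K' N (ρ → 𝔽) (fun k => Fin N → χ k → 𝔽) (τ → 𝔽)} (hs : s.Correct)
    {M R : ℝ} (hM : M * Fintype.card ρ = N * c) (hR : R * Fintype.card ρ = l) :
    HotplugAchievable K K' N M R := by
  classical
  have hcard : ∀ n, Fintype.card (Fin n → Bool) = 2 ^ n := fun n => by simp
  refine ⟨m * Fintype.card ρ, m * (c * N), m * l, Nat.mul_pos hm Fintype.card_pos, ?_, ?_,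
    hs.exists_transport ?_ (fun k => ?_) ?_⟩
  · push_cast
    apply le_of_eq
    linear_combination -(m : ℝ) * hM
  · push_cast
    apply le_of_eq
    linear_combination -(m : ℝ) * hR
  · exact Fintype.equivOfCardEq (by rw [hcard, Fintype.card_fun, h𝔽, pow_mul])
  · exact (Fintype.equivOfCardEq (by
      rw [hcard, Fintype.card_fun, Fintype.card_fun, Fintype.card_fin, h𝔽, hχ, pow_mul,
        pow_mul])).toEmbedding
  · exact (Fintype.equivOfCardEq (by
      rw [hcard, Fintype.card_fun, h𝔽, hτ, pow_mul])).toEmbedding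

/-- The cut-set bound for a single user. -/
theorem HotplugAchievable.one_le_add {K K' N : ℕ} (hK' : 0 < K') (hK : K' ≤ K) (hN : 0 < N)
    {M R : ℝ} (h : HotplugAchievable K K' N M R) : 1 ≤ M / N + R := by
  obtain ⟨B, c, l, hB, hc, hl, s, hs⟩ := h
  obtain ⟨I, -, hI⟩ := Finset.exists_subset_card_eq
    (s := (Finset.univ : Finset (Fin K))) (n := K') (by simpa using hK)
  obtain ⟨k, hk⟩ : I.Nonempty := Finset.card_pos.mp (by omega)
  -- A fixed cache and the transmissions for all N constant demands determine every file; comparing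
  -- sizes gives B N ≤ c + l N.
  have hinj : Function.Injective fun W : Fin N → Fin B → Bool =>
      (s.place k W, fun n : Fin N => s.deliver I hI (fun _ => n) W) := by
    intro W W' hWW'
    obtain ⟨hp, hd⟩ := Prod.mk.inj hWW'
    funext n
    obtain ⟨dec, hdec⟩ := hs I hI (fun _ => n) ⟨k, hk⟩
    rw [← hdec W, ← hdec W', hp, congrFun hd n]
  have hcard := Fintype.card_le_of_injective _ hinj
  simp only [Fintype.card_prod, Fintype.card_fun, Fintype.card_bool, Fintype.card_fin, ← pow_mul,
    ← pow_add] at hcard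
  have hle : B * N ≤ c + l * N := (Nat.pow_le_pow_iff_right (by norm_num)).mp hcard
  have hle' : (B : ℝ) * N ≤ c + l * N := by exact_mod_cast hle
  have hB' : (0 : ℝ) < B := by exact_mod_cast hB
  have hN' : (0 : ℝ) < N := by exact_mod_cast hN
  have hlN : (l : ℝ) * N ≤ R * B * N := mul_le_mul_of_nonneg_right hl hN'.le
  have hmain : (N : ℝ) * B ≤ (M + R * N) * B := by linarith
  have hdiv : (N : ℝ) ≤ M + R * N := le_of_mul_le_mul_right hmain hB'
  rw [← sub_le_iff_le_add, le_div_iff₀ hN']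
  linarith

/-- If `M / N ≥ 2 / 3`, then the cut-set bound is attained by a single user. -/
theorem isGreatest_cutSetValues {N K' : ℕ} {M : ℝ} (hN : 1 ≤ N) (hK' : 1 ≤ K')
    (hM : 2 / 3 ≤ M / N) : IsGreatest (cutSetValues N K' M) (1 - M / N) := by
  have hN' : (0 : ℝ) < N := by exact_mod_cast hN
  refine ⟨⟨1, ⟨le_rfl, le_min hN hK'⟩, by simp; ring⟩, ?_⟩
  rintro _ ⟨s, ⟨hs1, hs⟩, rfl⟩
  have hsN : s ≤ N := hs.trans (min_le_left _ _)
  have hq : 0 < N / s := Nat.div_pos hsN hs1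
  have hq' : (0 : ℝ) < (N / s : ℕ) := by exact_mod_cast hq
  have hqs : ((N / s : ℕ) : ℝ) * s ≤ N := by exact_mod_cast Nat.div_mul_le_self N s
  have hs1' : (1 : ℝ) ≤ s := by exact_mod_cast hs1
  -- Rounding N / s down only strengthens the subtracted term, so the value at s is at most s - s²
  -- M/N.
  have hratio : (s : ℝ) ≤ N / (N / s : ℕ) := by
    rw [le_div_iff₀ hq']
    linarith
  have hrw : (s : ℝ) / (N / s : ℕ) * M = s * (N / (N / s : ℕ)) * (M / N) := by
    field_simp
  have h₁ : (s : ℝ) * s * (M / N) ≤ s * (N / (N / s : ℕ)) * (M / N) := by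
    gcongr
  -- With μ = M/N, s - s² μ ≤ 1 - μ is s - 1 ≤ (s - 1)(s + 1) μ, and (s + 1) μ ≥ 4/3.
  have h₂ : ((s : ℝ) - 1) * 1 ≤ (s - 1) * ((s + 1) * (M / N)) := by
    apply mul_le_mul_of_nonneg_left _ (by linarith)
    nlinarith
  simp only [hrw]
  linarith

theorem mainTheorem3 (K N a₁ a₂ a : ℕ) (hKeven : Even K) (hK : 6 ≤ K) (hN : 1 ≤ N)
    (ha₁ : a₁ ≤ (K - 4).choose 2) (ha₂ : (a₂ : ℝ) ≤ 3 / 2 * ((K : ℝ) - 4))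
    (ha : a < a₂) (hsum : (K - 1).choose 2 = a + 3 * a₁ + 2 * a₂)
    (M R : ℝ) (hM : M / N = ((K - 1).choose 2 : ℝ) / (3 * ((a₁ : ℝ) + a₂)))
    (hR : R = (3 * ((a₁ : ℝ) + a₂) - ((K - 1).choose 2 : ℝ)) / (3 * ((a₁ : ℝ) + a₂))) :
    IsLeast {R' : ℝ | HotplugAchievable K 3 N M R'} R ∧
    R = 1 - M / N ∧ IsGreatest (cutSetValues N 3 M) R ∧
    (∃ (b : ℕ) (blk : Fin b → Finset (Fin K)), IsTDesign 3 K 4 3 blk) ∧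
    ∀ (b : ℕ) (blk : Fin b → Finset (Fin K)), IsTDesign 3 K 4 3 blk →
      IsHpPDA (designArray blk) (tArray 3 (levels a₁ a₂))
        b (3 * (a₁ + a₂)) ((K - 1).choose 2) (a₁ + 2 * a₂) (3 * a₁ + a₂) ∧
      ∃ T : Finset (TLabel 3 (levels a₁ a₂)),
        IsRemovable (tArray 3 (levels a₁ a₂)) ((K - 1).choose 2) (a₁ + 2 * a₂) T ∧
        R = (((3 * a₁ + a₂ : ℕ) : ℝ) - T.card) / ((3 * (a₁ + a₂) : ℕ) : ℝ) ∧
        ∀ (𝔽 : Type) [Field 𝔽] [Fintype 𝔽],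
          (b ≤ Fintype.card 𝔽 →
            ∃ G : Matrix (TRow 3 (levels a₁ a₂)) (Fin b) 𝔽, IsMDS G) ∧
          ∀ G : Matrix (TRow 3 (levels a₁ a₂)) (Fin b) 𝔽, IsMDS G →
            ∀ ζ : (I : Finset (Fin K)) → I.card = 3 → (TRow 3 (levels a₁ a₂) ↪ Fin b),
              (∀ I hI, StarAligned (designArray blk) (tArray 3 (levels a₁ a₂)) I hI (ζ I hI)) →
              (hpPDAScheme N (designArray blk) (tArray 3 (levels a₁ a₂)) ζ T G).Correct := by
  have hN' : (N : ℝ) ≠ 0 := by positivity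
  have hF' : (0 : ℝ) < 3 * ((a₁ : ℝ) + a₂) := by
    have : (0 : ℝ) < a₂ := by exact_mod_cast (Nat.zero_le a).trans_lt ha
    positivity
  have hsum' : ((K - 1).choose 2 : ℝ) = a + 3 * a₁ + 2 * a₂ := by exact_mod_cast hsum
  have ha₂' : 2 * a₂ ≤ 3 * (K - 4) := by
    have : (2 * a₂ : ℝ) ≤ 3 * ((K - 4 : ℕ) : ℝ) := by
      rw [Nat.cast_sub (by omega)]
      push_cast
      linarith
    exact_mod_cast this
  have hRM : R = 1 - M / N := by
    rw [hR, hM, sub_div, div_self hF'.ne']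
  have hRT : R = (((3 * a₁ + a₂ : ℕ) : ℝ) - (removedLabels a₁ a₂ a).card) /
      ((3 * (a₁ + a₂) : ℕ) : ℝ) := by
    rw [hR, card_removedLabels ha.le, hsum']
    push_cast
    congr 1
    ring
  have hremovable := removedLabels_isRemovable (a₁ := a₁) ha.le hsum
  refine ⟨⟨?_, fun R' hR' => ?_⟩, hRM, ?_, exists_isTDesign_of_even hKeven hK, ?_⟩
  · obtain ⟨b, blk, hd⟩ := exists_isTDesign_of_even hKeven hK
    have hP := hd.isHpPDA hK ha₁ ha₂' ha hsum
    have hcard := hP.pda.card_rows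
    have : Nonempty (TRow 3 (levels a₁ a₂)) := Fintype.card_pos_iff.mp (by omega)
    have : Fact (Nat.Prime 2) := ⟨Nat.prime_two⟩
    -- A field element then amounts to b + 1 bits, and 2 ^ (b + 1) ≥ b leaves enough evaluation
    -- points for the MDS code.
    have : Fintype (GaloisField 2 (b + 1)) := Fintype.ofFinite _
    have hcard𝔽 : Fintype.card (GaloisField 2 (b + 1)) = 2 ^ (b + 1) := by
      rw [← Nat.card_eq_fintype_card, GaloisField.card 2 (b + 1) (by omega)]
    obtain ⟨G, hG⟩ := exists_isMDS (ρ := TRow 3 (levels a₁ a₂)) (φ := Fin b)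
      (𝔽 := GaloisField 2 (b + 1)) (by
        rw [hcard𝔽, Fintype.card_fin]
        exact (Nat.lt_two_pow_self.trans (Nat.pow_lt_pow_right (by norm_num) (by omega))).le)
    choose ζ hζ using hP.aligned
    classical
    refine (hpPDAScheme_correct (N := N) hP hremovable hG hζ).achievable (m := b + 1)
      (c := (K - 1).choose 2) (l := 3 * a₁ + a₂ - (3 * a₁ + a)) (by omega) hcard𝔽 (fun k => ?_) ?_
      ?_ ?_
    · rw [← hP.stars k, ← Nat.card_eq_fintype_card]
      rfl
    · rw [Fintype.card_subtype_compl, hP.pda.card_integers, Fintype.card_coe,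
        card_removedLabels ha.le]
    · rw [hcard]
      rw [div_eq_div_iff hN' hF'.ne'] at hM
      push_cast
      linarith
    · rw [hcard, hRT, card_removedLabels ha.le, div_mul_cancel₀, Nat.cast_sub (by omega)]
      push_cast
      exact hF'.ne'
  · have := HotplugAchievable.one_le_add (by norm_num) (by omega) hN hR'
    linarith
  · rw [hRM]
    refine isGreatest_cutSetValues hN (by norm_num) ?_
    -- M/N ≥ 2/3 because Z - 2(a₁ + a₂) = a + a₁ ≥ 0.
    rw [hM, hsum', div_le_div_iff₀ (by norm_num) hF']
    have : (0 : ℝ) ≤ a := by positivity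
    have : (0 : ℝ) ≤ a₁ := by positivity
    linarith
  · intro b blk hd
    have hP := hd.isHpPDA hK ha₁ ha₂' ha hsum
    refine ⟨hP, removedLabels a₁ a₂ a, hremovable, hRT, fun 𝔽 _ _ => ⟨fun hb => ?_, ?_⟩⟩
    · exact exists_isMDS (by simpa using hb)
    · intro G hG ζ hζ
      exact hpPDAScheme_correct hP hremovable hG hζ
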